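/- **Setting.** Let $R$ be a commutative ring with identity and let $E=(E^0,E^1,r,s)$ be a directed graph that is row-finite with no sources: for every vertex $v$ the set $vE^1:=\{e\in E^1: r(e)=v\}$ is finite and nonempty. A path is either a vertex or a word $\lambda=e_1\cdots e_n$ of edges with $s(e_i)=r(e_{i+1})$; put $r(\lambda)=r(e_1)$, $s(\lambda)=s(e_n)$ (and $r(v)=s(v)=v$ for a vertex $v$). A cycle based at $v$ is a path $e_1\cdots e_n$ with $n\ge 1$, range and source $v$, and $s(e_1),\dots,s(e_n)$ distinct; a return path based at $v$ is a path $e_1\cdots e_n$ with $n\geq 1$, range and source $v$, and $s(e_i)\neq v$ for $i<n$. Assume Condition (K): for every $v\in E^0$, either there is no cycle based at $v$, or there are at least two distinct return paths based at $v$. Let $L_R(E)$ be the Leavitt path algebra, i.e. the universal (not necessarily unital) $R$-algebra generated by elements $p_v$ ($v\in E^0$), $s_e$ and $s_{e^*}$ ($e\in E^1$) such that the $p_v$ are mutually orthogonal idempotents, $p_{r(e)}s_e=s_e=s_ep_{s(e)}$, $p_{s(e)}s_{e^*}=s_{e^*}=s_{e^*}p_{r(e)}$, $s_{e^*}s_f=\delta_{e,f}\,p_{s(e)}$,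 and $p_v=\sum_{e\in vE^1}s_es_{e^*}$. For a path $\lambda=e_1\cdots e_n$ put $s_\lambda=s_{e_1}\cdots s_{e_n}$ and $s_{\lambda^*}=s_{e_n^*}\cdots s_{e_1^*}$, with $s_v=s_{v^*}=p_v$ for a vertex $v$. Ideals are two-sided, and $\mathcal L(A)$ denotes the set of ideals of a ring $A$. A set $H\subseteq E^0$ is hereditary if $r(e)\in H$ implies $s(e)\in H$ for all $e\in E^1$, and saturated if $s(vE^1)\subseteq H$ implies $v\in H$ for all $v\in E^0$. Let $\mathcal H_E$ be the set of all saturated hereditary subsets of $E^0$ (including $\emptyset$). For $\mathcal A\subseteq\mathcal H_E$ let $\bigvee\mathcal A$ be the smallest element of $\mathcal H_E$ containing every member of $\mathcal A$. For $H\in\mathcal H_E$ let $I_H$ be the ideal of $L_R(E)$ generated by $\{p_v:v\in H\}$. **Theorem.** 1. For every ideal $I$ of $L_R(E)$, $$I=\operatorname{span}_R\{r s_\lambda s_{\mu^*} : r\in R,\ \lambda,\mu \text{ paths},\ r p_{s(\mu)}\in I\}.$$ 2. Let $\mathcal F$ be the set of all functions $\pi:\mathcal H_E\to\mathcal L(R)$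 such that $\pi\big(\bigvee\mathcal A\big)=\bigcap_{H\in\mathcal A}\pi(H)$ for all $\mathcal A\subseteq\mathcal H_E$ (the empty intersection being $R$). For each $\pi\in\mathcal F$ the set $$\Gamma(\pi)=\operatorname{span}_R\{r s_\mu s_{\nu^*} : \mu,\nu\text{ paths and there exists } H\in\mathcal H_E \text{ with } r\in\pi(H) \text{ and } s_\mu s_{\nu^*}\in I_H\}$$ is an ideal of $L_R(E)$, and $\Gamma:\mathcal F\to\mathcal L(L_R(E))$ is a bijection. 3. For $\pi_1,\pi_2\in\mathcal F$, $\Gamma(\pi_1)\subseteq\Gamma(\pi_2)$ if and only if $\pi_1(H)\subseteq\pi_2(H)$ for all $H\in\mathcal H_E$. -/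

import Mathlib

/-- A directed graph `(E⁰, E¹, r, s)` with vertex set `V` and edge set `W`; multiple edges and loops
are allowed. An edge `e` points from `s e` to `r e`. -/
structure DirectedGraph (V : Type*) (W : Type*) where
  /-- the range of an edge -/
  r : W → V
  /-- the source of an edge -/
  s : W → V

namespace DirectedGraph

section Graphs

variable {V W : Type*} (E : DirectedGraph V W)

/-- The set `vE¹` of edges with range `v`. -/
def edgesInto (v : V) : Set W := {e | E.r e = v}

/-- Every vertex receives only finitely many edges. -/
def RowFinite : Prop := ∀ v, (E.edgesInto v).Finite

/-- Every vertex receives at least one edge. -/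
def NoSources : Prop := ∀ v, (E.edgesInto v).Nonempty

/-- `E.IsPath v l w` says that the list `l = [e₁, …, eₙ]` of edges satisfies `s eᵢ = r eᵢ₊₁`, and is
a path with range `v` and source `w`. The empty list is a path from `v` to `v`. -/
def IsPath : V → List W → V → Prop
  | v, [], w => v = w
  | v, e :: l, w => E.r e = v ∧ IsPath (E.s e) l w

/-- The finite paths `λ = e₁ e₂ ⋯ eₙ` (`n ≥ 0`) in `E`, with `s eᵢ = r eᵢ₊₁`,
`r(λ) = r e₁` and `s(λ) = s eₙ`; paths of length zero are the vertices. -/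
structure Path where
  /-- the edges `e₁, …, eₙ` -/
  edges : List W
  /-- the range `r(λ)` -/
  range : V
  /-- the source `s(λ)` -/
  source : V
  isPath : E.IsPath range edges source

variable {E}

/-- `α` is a cycle based at `v`: a path of positive length from `v` to `v` whose edges have
pairwise distinct sources. -/
def Path.IsCycleAt (α : E.Path) (v : V) : Prop :=
  α.edges ≠ [] ∧ α.range = v ∧ α.source = v ∧ (α.edges.map E.s).Nodup

/-- `α` is a return path based at `v`: a path of positive length from `v` to `v` that does not pass
through `v` in between. -/
def Path.IsReturnPathAt (α : E.Path) (v : V) : Prop :=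
  α.edges ≠ [] ∧ α.range = v ∧ α.source = v ∧ ∀ e ∈ α.edges.dropLast, E.s e ≠ v

variable (E)

/-- Condition (K): for every vertex `v`, either there is no cycle based at `v`, or there are at
least two distinct return paths based at `v`. -/
def ConditionK : Prop :=
  ∀ v, (¬ ∃ α : E.Path, α.IsCycleAt v) ∨
    ∃ α β : E.Path, α ≠ β ∧ α.IsReturnPathAt v ∧ β.IsReturnPathAt v

/-- `r(e) ∈ H` implies `s(e) ∈ H`. -/
def Hereditary (H : Set V) : Prop := ∀ e, E.r e ∈ H → E.s e ∈ H

/-- `s(vE¹) ⊆ H` implies `v ∈ H`. -/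
def Saturated (H : Set V) : Prop := ∀ v, E.s '' E.edgesInto v ⊆ H → v ∈ H

/-- The collection `ℋ_E` of saturated hereditary subsets of `E⁰`. -/
def SatHer : Type _ := {H : Set V // E.Saturated H ∧ E.Hereditary H}

variable {E}

/-- The join `⋁ A`: the intersection of all saturated hereditary sets that contain every member of
`A`, i.e. the smallest saturated hereditary set containing every member of `A`. -/
def SatHer.join (A : Set E.SatHer) : E.SatHer :=
  ⟨⋂ H ∈ {H : E.SatHer | ∀ K ∈ A, K.1 ⊆ H.1}, H.1, by
    constructor
    · intro v hv
      simp only [Set.mem_iInter] at hv ⊢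
      exact fun H hH => H.2.1 v fun x hx => Set.mem_iInter₂.1 (hv hx) H hH
    · intro e he
      simp only [Set.mem_iInter] at he ⊢
      exact fun H hH => H.2.2 e (he H hH)⟩

end Graphs

section Algebra

variable {V W : Type*}

/-- The generators `p_v`, `s_e`, `s_{e*}` of the Leavitt path algebra. -/
inductive Gen (E : DirectedGraph V W) : Type _
  | vertex (v : V) : Gen E
  | edge (e : W) : Gen E
  | ghost (e : W) : Gen E

/-- `(p, s, t)`, with `t e` in the role of `s_{e*}`, is a Leavitt `E`-family in the ring `B`. The
last relation is imposed at those vertices that receive a finite nonzero number of edges; these are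
all vertices if `E` is row-finite with no sources. -/
structure IsLeavittFamily (E : DirectedGraph V W) {B : Type*} [NonUnitalRing B]
    (p : V → B) (s t : W → B) : Prop where
  vertex_mul_self : ∀ v, p v * p v = p v
  vertex_mul_ne : ∀ v w, v ≠ w → p v * p w = 0
  range_mul_edge : ∀ e, p (E.r e) * s e = s e
  edge_mul_source : ∀ e, s e * p (E.s e) = s e
  source_mul_ghost : ∀ e, p (E.s e) * t e = t e
  ghost_mul_range : ∀ e, t e * p (E.r e) = t e
  ghost_mul_edge : ∀ e, t e * s e = p (E.s e)
  ghost_mul_edge_ne : ∀ e f, e ≠ f → t e * s f = 0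
  vertex_eq_sum : ∀ v, ∀ h : (E.edgesInto v).Finite, (E.edgesInto v).Nonempty →
    p v = ∑ e ∈ h.toFinset, s e * t e

variable (R : Type*) [CommRing R] (E : DirectedGraph V W)

open FreeAlgebra in
/-- The relations of a Leavitt `E`-family, imposed on the free unital `R`-algebra on the
generators. -/
inductive LeavittRel : FreeAlgebra R E.Gen → FreeAlgebra R E.Gen → Prop
  | vertex_mul_self (v : V) :
      LeavittRel (ι R (Gen.vertex v) * ι R (Gen.vertex v)) (ι R (Gen.vertex v))
  | vertex_mul_ne (v w : V) (h : v ≠ w) :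
      LeavittRel (ι R (Gen.vertex v) * ι R (Gen.vertex w)) 0
  | range_mul_edge (e : W) :
      LeavittRel (ι R (Gen.vertex (E.r e)) * ι R (Gen.edge e)) (ι R (Gen.edge e))
  | edge_mul_source (e : W) :
      LeavittRel (ι R (Gen.edge e) * ι R (Gen.vertex (E.s e))) (ι R (Gen.edge e))
  | source_mul_ghost (e : W) :
      LeavittRel (ι R (Gen.vertex (E.s e)) * ι R (Gen.ghost e)) (ι R (Gen.ghost e))
  | ghost_mul_range (e : W) :
      LeavittRel (ι R (Gen.ghost e) * ι R (Gen.vertex (E.r e))) (ι R (Gen.ghost e))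
  | ghost_mul_edge (e : W) :
      LeavittRel (ι R (Gen.ghost e) * ι R (Gen.edge e)) (ι R (Gen.vertex (E.s e)))
  | ghost_mul_edge_ne (e f : W) (h : e ≠ f) :
      LeavittRel (ι R (Gen.ghost e) * ι R (Gen.edge f)) 0
  | vertex_eq_sum (v : V) (h : (E.edgesInto v).Finite) (h' : (E.edgesInto v).Nonempty) :
      LeavittRel (ι R (Gen.vertex v))
        (∑ e ∈ h.toFinset, ι R (Gen.edge e) * ι R (Gen.ghost e))

/-- The unital `R`-algebra presented by the Leavitt relations. (It is the Leavitt path algebra with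
an identity freely adjoined.) -/
abbrev LeavittUnital : Type _ := RingQuot (LeavittRel R E)

/-- The image of a generator in the unital algebra. -/
def genU (g : E.Gen) : LeavittUnital R E :=
  RingQuot.mkAlgHom R (LeavittRel R E) (FreeAlgebra.ι R g)

/-- The Leavitt path algebra `L_R(E)`: the (in general non-unital) `R`-algebra generated by
`p_v, s_e, s_{e*}` subject to the Leavitt relations, realised as the non-unital subalgebra that the
generators generate inside the unital algebra with the same presentation. It carries the universal
Leavitt `E`-family, see `leavitt_isLeavittFamily` and `leavitt_universal`. -/
abbrev LeavittPathAlgebra : Type _ :=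
  (NonUnitalAlgebra.adjoin R (Set.range (genU R E)) :
    NonUnitalSubalgebra R (LeavittUnital R E))

variable {E}

/-- The image of a generator in `L_R(E)`. -/
def gen (g : E.Gen) : LeavittPathAlgebra R E :=
  ⟨genU R E g, NonUnitalAlgebra.subset_adjoin R ⟨g, rfl⟩⟩

/-- The idempotent `p_v`. -/
def p (v : V) : LeavittPathAlgebra R E := gen R (Gen.vertex v)

/-- The element `s_λ = s_{e₁} ⋯ s_{eₙ} p_w` for a list of edges `e₁, …, eₙ`; if this is a path with
source `w` then the factor `p_w` may be dropped unless `n = 0`, where `s_w = p_w`. -/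
def sList : List W → V → LeavittPathAlgebra R E
  | [], w => p R w
  | e :: l, w => gen R (Gen.edge e) * sList l w

/-- The element `p_w s_{eₙ*} ⋯ s_{e₁*}` for a list of edges `e₁, …, eₙ`. -/
def sStarList : List W → V → LeavittPathAlgebra R E
  | [], w => p R w
  | e :: l, w => sStarList l w * gen R (Gen.ghost e)

/-- `s_λ` for a path `λ`. -/
def sPath (l : E.Path) : LeavittPathAlgebra R E := sList R l.edges l.source

/-- `s_{λ*}` for a path `λ`. -/
def sStarPath (l : E.Path) : LeavittPathAlgebra R E := sStarList R l.edges l.source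

theorem leavitt_isLeavittFamily :
    E.IsLeavittFamily (B := LeavittPathAlgebra R E) (p R)
      (fun e => gen R (Gen.edge e)) (fun e => gen R (Gen.ghost e)) := by
  have key : ∀ {a b}, LeavittRel R E a b →
      RingQuot.mkAlgHom R (LeavittRel R E) a = RingQuot.mkAlgHom R (LeavittRel R E) b :=
    fun h => RingQuot.mkAlgHom_rel R h
  constructor
  · intro v; apply Subtype.ext; simpa [p, gen, genU] using key (LeavittRel.vertex_mul_self v)
  · intro v w h; apply Subtype.ext; simpa [p, gen, genU] using key (LeavittRel.vertex_mul_ne v w h)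
  · intro e; apply Subtype.ext; simpa [p, gen, genU] using key (LeavittRel.range_mul_edge e)
  · intro e; apply Subtype.ext; simpa [p, gen, genU] using key (LeavittRel.edge_mul_source e)
  · intro e; apply Subtype.ext; simpa [p, gen, genU] using key (LeavittRel.source_mul_ghost e)
  · intro e; apply Subtype.ext; simpa [p, gen, genU] using key (LeavittRel.ghost_mul_range e)
  · intro e; apply Subtype.ext; simpa [p, gen, genU] using key (LeavittRel.ghost_mul_edge e)
  · intro e f h; apply Subtype.ext; simpa [p, gen, genU] using key (LeavittRel.ghost_mul_edge_ne e f h)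
  · intro v h h'
    apply Subtype.ext
    rw [AddSubmonoidClass.coe_finsetSum]
    simpa [p, gen, genU] using key (LeavittRel.vertex_eq_sum v h h')

/-- Every Leavitt `E`-family in a (not necessarily unital) `R`-algebra is the image of the generators
of `L_R(E)` under a unique homomorphism of `R`-algebras. -/
theorem leavitt_universal {B : Type*} [NonUnitalRing B] [Module R B] [IsScalarTower R B B]
    [SMulCommClass R B B] {q : V → B} {s t : W → B} (h : E.IsLeavittFamily q s t) :
    ∃! φ : LeavittPathAlgebra R E →ₙₐ[R] B,
      (∀ v, φ (p R v) = q v) ∧ (∀ e, φ (gen R (Gen.edge e)) = s e) ∧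
        ∀ e, φ (gen R (Gen.ghost e)) = t e := by
  let f : E.Gen → Unitization R B
    | .vertex v => (q v : Unitization R B)
    | .edge e => (s e : Unitization R B)
    | .ghost e => (t e : Unitization R B)
  have hrel : ∀ ⦃a b⦄, LeavittRel R E a b → FreeAlgebra.lift R f a = FreeAlgebra.lift R f b := by
    intro a b hab
    cases hab with
    | vertex_mul_self v => simp [f, ← Unitization.inr_mul, h.vertex_mul_self]
    | vertex_mul_ne v w hvw => simp [f, ← Unitization.inr_mul, h.vertex_mul_ne v w hvw]
    | range_mul_edge e => simp [f, ← Unitization.inr_mul, h.range_mul_edge]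
    | edge_mul_source e => simp [f, ← Unitization.inr_mul, h.edge_mul_source]
    | source_mul_ghost e => simp [f, ← Unitization.inr_mul, h.source_mul_ghost]
    | ghost_mul_range e => simp [f, ← Unitization.inr_mul, h.ghost_mul_range]
    | ghost_mul_edge e => simp [f, ← Unitization.inr_mul, h.ghost_mul_edge]
    | ghost_mul_edge_ne e e' hne => simp [f, ← Unitization.inr_mul, h.ghost_mul_edge_ne e e' hne]
    | vertex_eq_sum v hv hv' =>
      simp only [map_sum, map_mul, FreeAlgebra.lift_ι_apply, f, ← Unitization.inr_mul]
      rw [h.vertex_eq_sum v hv hv']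
      exact map_sum (Unitization.inrNonUnitalAlgHom R B) _ _
  let F : LeavittUnital R E →ₐ[R] Unitization R B :=
    RingQuot.liftAlgHom R ⟨FreeAlgebra.lift R f, hrel⟩
  have hF : ∀ g, F (genU R E g) = f g := fun g => by simp [F, genU]
  have hfst : ∀ x : LeavittPathAlgebra R E, (F x.1).fst = 0 := by
    rintro ⟨x, hx⟩
    induction hx using NonUnitalAlgebra.adjoin_induction with
    | mem x hx => obtain ⟨g, rfl⟩ := hx; cases g <;> simp [hF, f]
    | add x y _ _ hx hy => simp_all
    | zero => simp
    | mul x y _ _ hx hy => simp_all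
    | smul r x _ hx => simp_all
  refine ⟨{ toFun := fun x => (F x.1).snd
            map_smul' := fun r x => by simp
            map_zero' := by simp
            map_add' := fun x y => by simp
            map_mul' := fun x y => by simp [hfst] }, ?_, ?_⟩
  · refine ⟨fun v => ?_, fun e => ?_, fun e => ?_⟩ <;> simp [p, gen, hF, f]
  · rintro ψ ⟨h₁, h₂, h₃⟩
    have main : ∀ (x : LeavittUnital R E) (hx : x ∈ NonUnitalAlgebra.adjoin R (Set.range (genU R E))),
        ψ ⟨x, hx⟩ = (F x).snd := by
      intro x hx
      induction hx using NonUnitalAlgebra.adjoin_induction with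
      | mem x hx =>
        obtain ⟨g, rfl⟩ := hx
        rw [hF]
        cases g with
        | vertex v => exact h₁ v
        | edge e => exact h₂ e
        | ghost e => exact h₃ e
      | add x y hx' hy' hx hy =>
        rw [map_add, Unitization.snd_add, ← hx, ← hy]
        exact map_add ψ ⟨x, hx'⟩ ⟨y, hy'⟩
      | zero => rw [map_zero]; exact map_zero ψ
      | mul x y hx' hy' hx hy =>
        have e₁ : (F x).fst = 0 := hfst ⟨x, hx'⟩
        have e₂ : (F y).fst = 0 := hfst ⟨y, hy'⟩
        rw [map_mul, Unitization.snd_mul, e₁, e₂, zero_smul, zero_smul, zero_add, zero_add, ← hx,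
          ← hy]
        exact map_mul ψ ⟨x, hx'⟩ ⟨y, hy'⟩
      | smul r x hx' hx =>
        rw [map_smul, Unitization.snd_smul, ← hx]
        exact map_smul ψ r ⟨x, hx'⟩
    ext x
    exact main x.1 x.2

end Algebra

section Ideals

variable {V W : Type*} (R : Type*) [CommRing R] {E : DirectedGraph V W}

/-- The ideal `I_H` of `L_R(E)` generated by `{p_v : v ∈ H}`. -/
def idealOf (H : E.SatHer) : TwoSidedIdeal (LeavittPathAlgebra R E) :=
  TwoSidedIdeal.span (p R '' H.1)

variable (E) in
/-- The set `ℱ` of functions `π : ℋ_E → ℒ(R)` with `π (⋁ A) = ⋂_{H ∈ A} π H` for all `A ⊆ ℋ_E`.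
(For `A = ∅` this reads `π ∅ = R`, if `E` has no sources.) -/
def IdealFun : Type _ :=
  {π : E.SatHer → Ideal R // ∀ A : Set E.SatHer, π (SatHer.join A) = ⨅ H ∈ A, π H}

variable {R}

/-- `span_R {r s_λ s_{μ*} : r p_{s(μ)} ∈ I}`. -/
def idealSpan (I : TwoSidedIdeal (LeavittPathAlgebra R E)) :
    Submodule R (LeavittPathAlgebra R E) :=
  Submodule.span R {x | ∃ (a : R) (l m : E.Path),
    a • p R m.source ∈ I ∧ x = a • (sPath R l * sStarPath R m)}

/-- `span_R {r s_μ s_{ν*} : there is H ∈ ℋ_E with r ∈ π(H) and s_μ s_{ν*} ∈ I_H}`. -/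
def gammaSpan (π : IdealFun R E) : Submodule R (LeavittPathAlgebra R E) :=
  Submodule.span R {x | ∃ (a : R) (m n : E.Path),
    (∃ H : E.SatHer, a ∈ π.1 H ∧ sPath R m * sStarPath R n ∈ idealOf R H) ∧
      x = a • (sPath R m * sStarPath R n)}

end Ideals

end DirectedGraph

/-!
Throughout, paths are handled as lists of edges, and `λ`, `μ` stand for paths.

**Every ideal `I` is spanned by the `r s_λ s_{μ*}` with `r p_{s(μ)} ∈ I`.** Since
`p_v = ∑ s_e s_{e*}`, each `x ∈ I` is a combination of monomials `s_λ s_{μ*}` with all `μ` of one length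
(`exists_mem_monomialSpan`). Then `x s_μ` is a combination of elements `s_λ`, for distinct `λ` with a common
source `v`, and it is enough to see that each coefficient multiplies `p_v` into `I`
(`smul_p_mem_of_sum_mem`). Multiplication by `s_{λ*}`, for a shortest `λ`, leads to an element
`r p_v + ∑ r_j s_{β_j}` of `I` with closed paths `β_j` at `v`. Condition (K) gives, for each closed path
`β`, a closed path `γ` at `v` that is not an initial segment of `β γ`
(`ConditionK.exists_not_prefix`), so that `s_{γ*} s_β s_γ = 0`. Conjugation by such `γ` preserves
`r p_v`, removes the terms `r_j s_{β_j}` one after another, and shows that `r p_v ∈ I`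
(`smul_p_mem_of_add_closed`).

**The correspondence.** A function `π` in `ℱ` is the same as the family of its level sets: among the `H`
with `a ∈ π H` there is a largest one, `π.level a`, and `a ∈ π H` if and only if `H ⊆ π.level a`. Let
`Γ π` be the ideal generated by the `a p_v` with `v ∈ π.level a`. It contains no other `a p_v`
(`smul_p_mem_gammaIdeal`): if `w ∉ π.level a`, saturation provides an infinite path `ξ` from `w` outside
`π.level a`, and `L_R(E)` acts on functions on the infinite paths that meet the same level sets as `ξ`, with
values in the quotient of `R` by the ideal of all `b` for which `ξ` meets `π.level b`. This action kills
`Γ π` but not `a p_w`. Hence `Γ π` determines `π` together with its order, and by the description of ideals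
above `Γ π` is the span `gammaSpan π`. Conversely the vertices `v` with `a p_v ∈ I` form a saturated
hereditary set for each `a`; these are the level sets of a function `π` with `Γ π = I`.
-/

namespace DirectedGraph

section Combinatorics

variable {V W : Type*} {E : DirectedGraph V W}

/-! ### Paths as lists of edges -/

theorem isPath_append {u w : V} {a b : List W} :
    E.IsPath u (a ++ b) w ↔ ∃ x, E.IsPath u a x ∧ E.IsPath x b w := by
  induction a generalizing u with
  | nil => simp [IsPath]
  | cons e a ih => simp [IsPath, ih, and_assoc]

theorem IsPath.source_unique {u u' w w' : V} {l : List W} (hl : l ≠ [])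
    (h : E.IsPath u l w) (h' : E.IsPath u' l w') : w = w' := by
  induction l generalizing u u' with
  | nil => exact absurd rfl hl
  | cons e l ih =>
    obtain ⟨-, h⟩ := h
    obtain ⟨-, h'⟩ := h'
    cases l with
    | nil => exact h.symm.trans h'
    | cons f l => exact ih (by simp) h h'

theorem IsPath.source_getLast {u w : V} {l : List W} (hl : l ≠ []) (h : E.IsPath u l w) :
    E.s (l.getLast hl) = w := by
  induction l generalizing u with
  | nil => exact absurd rfl hl
  | cons e l ih =>
    cases l with
    | nil => exact h.2
    | cons f l => simpa using ih (by simp) h.2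

/-- A path of positive length can be shortened, keeping its range and its source, until the sources
of its edges are distinct: cut out the part between two occurrences of a vertex. -/
theorem IsPath.exists_nodup {u w : V} {l : List W} (hl : l ≠ []) (h : E.IsPath u l w) :
    ∃ l', l' ≠ [] ∧ E.IsPath u l' w ∧ (l'.map E.s).Nodup := by
  induction l generalizing u with
  | nil => exact absurd rfl hl
  | cons e l ih =>
    obtain ⟨hr, hp⟩ := h
    by_cases hl0 : l = []
    · subst hl0
      exact ⟨[e], by simp, ⟨hr, hp⟩, by simp⟩
    obtain ⟨l', -, hp', hnd⟩ := ih hl0 hp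
    by_cases hmem : E.s e ∈ l'.map E.s
    · obtain ⟨f, hf, hfe⟩ := List.mem_map.1 hmem
      obtain ⟨a, b, rfl⟩ := List.append_of_mem hf
      obtain ⟨x, -, hx⟩ := isPath_append.1 hp'
      refine ⟨e :: b, by simp, ⟨hr, hfe ▸ hx.2⟩, ?_⟩
      rw [List.map_append, List.map_cons] at hnd
      rw [List.map_cons, ← hfe]
      exact hnd.of_append_right
    · exact ⟨e :: l', by simp, ⟨hr, hp'⟩, by simpa using ⟨by simpa using hmem, hnd⟩⟩

/-- A closed path cannot be a proper initial segment of a return path. -/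
theorem Path.IsReturnPathAt.eq_of_prefix {v : V} {α : E.Path} (hα : α.IsReturnPathAt v)
    {b : List W} (hb : b ≠ []) (hp : E.IsPath v b v) (hpre : b <+: α.edges) : b = α.edges := by
  obtain ⟨t, ht⟩ := hpre
  by_cases ht0 : t = []
  · simpa [ht0] using ht
  refine absurd (hp.source_getLast hb) (hα.2.2.2 _ ?_)
  rw [← ht, List.dropLast_append_of_ne_nil ht0]
  exact List.mem_append_left _ (List.getLast_mem hb)

theorem Path.IsReturnPathAt.isPath_edges {v : V} {α : E.Path} (hα : α.IsReturnPathAt v) :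
    E.IsPath v α.edges v := by
  have h := α.isPath
  rwa [hα.2.1, hα.2.2.1] at h

/-- Under Condition (K), every closed path `b` at `v` admits a closed path `g` at `v` such that `g` is
not an initial segment of `b g`. Such a `g` is found among two distinct return paths: if both failed, both
would be initial segments of `b`, hence comparable, hence equal. -/
theorem ConditionK.exists_not_prefix (hK : E.ConditionK) {v : V} {b : List W} (hb : b ≠ [])
    (hp : E.IsPath v b v) : ∃ g : List W, E.IsPath v g v ∧ ¬ g <+: b ++ g := by
  have hcyc : ∃ α : E.Path, α.IsCycleAt v := by
    obtain ⟨l, hl, hpl, hnd⟩ := hp.exists_nodup hb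
    exact ⟨⟨l, v, v, hpl⟩, hl, rfl, rfl, hnd⟩
  obtain h | ⟨α, β, hne, hα, hβ⟩ := hK v
  · exact absurd hcyc h
  by_contra! hall
  -- A return path `γ` that begins `b γ` begins `b` as well.
  have key : ∀ γ : E.Path, γ.IsReturnPathAt v → γ.edges <+: b := by
    intro γ hγ
    have h₁ := hall _ hγ.isPath_edges
    rcases List.prefix_or_prefix_of_prefix h₁ (List.prefix_append b γ.edges) with h | h
    · exact h
    · rw [hγ.eq_of_prefix hb hp h]
  have hedges : α.edges = β.edges := by
    rcases List.prefix_or_prefix_of_prefix (key α hα) (key β hβ) with h | h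
    · exact hβ.eq_of_prefix hα.1 hα.isPath_edges h
    · exact (hα.eq_of_prefix hβ.1 hβ.isPath_edges h).symm
  have hrange : α.range = β.range := hα.2.1.trans hβ.2.1.symm
  have hsource : α.source = β.source := hα.2.2.1.trans hβ.2.2.1.symm
  clear key hα hβ
  cases α
  cases β
  simp_all

end Combinatorics

section Calculus

variable {V W : Type*} {R : Type*} [CommRing R] {E : DirectedGraph V W}

/-! ### Products of the elements `s_λ` and `s_{λ*}` -/

theorem p_mul_p (v : V) : (p R v : LeavittPathAlgebra R E) * p R v = p R v :=
  (leavitt_isLeavittFamily R).vertex_mul_self v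

theorem p_mul_p_ne {v w : V} (h : v ≠ w) : (p R v : LeavittPathAlgebra R E) * p R w = 0 :=
  (leavitt_isLeavittFamily R).vertex_mul_ne v w h

theorem p_mul_edge (e : W) :
    (p R (E.r e) : LeavittPathAlgebra R E) * gen R (Gen.edge e) = gen R (Gen.edge e) :=
  (leavitt_isLeavittFamily R).range_mul_edge e

theorem edge_mul_p (e : W) :
    (gen R (Gen.edge e) : LeavittPathAlgebra R E) * p R (E.s e) = gen R (Gen.edge e) :=
  (leavitt_isLeavittFamily R).edge_mul_source e

theorem p_mul_ghost (e : W) :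
    (p R (E.s e) : LeavittPathAlgebra R E) * gen R (Gen.ghost e) = gen R (Gen.ghost e) :=
  (leavitt_isLeavittFamily R).source_mul_ghost e

theorem ghost_mul_p (e : W) :
    (gen R (Gen.ghost e) : LeavittPathAlgebra R E) * p R (E.r e) = gen R (Gen.ghost e) :=
  (leavitt_isLeavittFamily R).ghost_mul_range e

theorem ghost_mul_edge (e : W) :
    (gen R (Gen.ghost e) : LeavittPathAlgebra R E) * gen R (Gen.edge e) = p R (E.s e) :=
  (leavitt_isLeavittFamily R).ghost_mul_edge e

theorem ghost_mul_edge_ne {e f : W} (h : e ≠ f) :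
    (gen R (Gen.ghost e) : LeavittPathAlgebra R E) * gen R (Gen.edge f) = 0 :=
  (leavitt_isLeavittFamily R).ghost_mul_edge_ne e f h

theorem p_eq_sum (hfin : E.RowFinite) (hsrc : E.NoSources) (v : V) :
    (p R v : LeavittPathAlgebra R E) =
      ∑ e ∈ (hfin v).toFinset, gen R (Gen.edge e) * gen R (Gen.ghost e) :=
  (leavitt_isLeavittFamily R).vertex_eq_sum v (hfin v) (hsrc v)

theorem p_mul_sList {u w : V} {l : List W} (h : E.IsPath u l w) :
    (p R u : LeavittPathAlgebra R E) * sList R l w = sList R l w := by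
  cases l with
  | nil => cases h; exact p_mul_p _
  | cons e l => obtain ⟨rfl, -⟩ := h; rw [sList, ← mul_assoc, p_mul_edge]

theorem sList_mul_p (l : List W) (w : V) :
    (sList R l w : LeavittPathAlgebra R E) * p R w = sList R l w := by
  induction l with
  | nil => exact p_mul_p _
  | cons e l ih => rw [sList, mul_assoc, ih]

theorem p_mul_sStarList (l : List W) (w : V) :
    (p R w : LeavittPathAlgebra R E) * sStarList R l w = sStarList R l w := by
  induction l with
  | nil => exact p_mul_p _
  | cons e l ih => rw [sStarList, ← mul_assoc, ih]

theorem sStarList_mul_p {u w : V} {l : List W} (h : E.IsPath u l w) :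
    (sStarList R l w : LeavittPathAlgebra R E) * p R u = sStarList R l w := by
  cases l with
  | nil => cases h; exact p_mul_p _
  | cons e l => obtain ⟨rfl, -⟩ := h; rw [sStarList, mul_assoc, ghost_mul_p]

theorem p_mul_sList_ne {u v w : V} {l : List W} (h : E.IsPath u l w) (hne : v ≠ u) :
    (p R v : LeavittPathAlgebra R E) * sList R l w = 0 := by
  rw [← p_mul_sList h, ← mul_assoc, p_mul_p_ne hne, zero_mul]

theorem sList_mul_sList {u v w : V} {a b : List W} (h : E.IsPath u a v) (h' : E.IsPath v b w) :
    (sList R a v : LeavittPathAlgebra R E) * sList R b w = sList R (a ++ b) w := by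
  induction a generalizing u with
  | nil => exact p_mul_sList h'
  | cons e a ih => rw [sList, mul_assoc, ih h.2, List.cons_append, sList]

theorem sStarList_mul_sList_append {u v w : V} {a b : List W} (h : E.IsPath u a v)
    (h' : E.IsPath v b w) :
    (sStarList R a v : LeavittPathAlgebra R E) * sList R (a ++ b) w = sList R b w := by
  induction a generalizing u with
  | nil => exact p_mul_sList h'
  | cons e a ih =>
    rw [sStarList, List.cons_append, sList, mul_assoc, ← mul_assoc (gen R (Gen.ghost e)),
      ghost_mul_edge, p_mul_sList (isPath_append.2 ⟨v, h.2, h'⟩), ih h.2]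

theorem sStarList_mul_sList_self {u v : V} {a : List W} (h : E.IsPath u a v) :
    (sStarList R a v : LeavittPathAlgebra R E) * sList R a v = p R v := by
  simpa [sList] using sStarList_mul_sList_append (R := R) (b := []) h rfl

/-- `s_{a*} s_b = 0` if `b` is at least as long as `a` and does not begin with `a`. -/
theorem sStarList_mul_sList_of_not_prefix {u w : V} {a b : List W} (v : V) (h : E.IsPath u b w)
    (hlen : a.length ≤ b.length) (hpre : ¬ a <+: b) :
    (sStarList R a v : LeavittPathAlgebra R E) * sList R b w = 0 := by
  induction a generalizing u b with
  | nil => exact absurd List.nil_prefix hpre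
  | cons e a ih =>
    cases b with
    | nil => simp at hlen
    | cons f b =>
      rw [sStarList, sList, mul_assoc, ← mul_assoc (gen R (Gen.ghost e))]
      by_cases hef : e = f
      · subst hef
        rw [ghost_mul_edge, p_mul_sList h.2]
        exact ih h.2 (by simpa using hlen) fun h' => hpre (by simpa using h')
      · rw [ghost_mul_edge_ne hef, zero_mul, mul_zero]

theorem sStarList_append_singleton (e : W) (m : List W) :
    (sStarList R (m ++ [e]) (E.s e) : LeavittPathAlgebra R E) =
      gen R (Gen.ghost e) * sStarList R m (E.r e) := by
  induction m with
  | nil => simp only [List.nil_append, sStarList]; rw [p_mul_ghost, ghost_mul_p]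
  | cons f m ih => rw [List.cons_append, sStarList, ih, sStarList, mul_assoc]

theorem sList_append_singleton {u : V} (e : W) {l : List W} (h : E.IsPath u l (E.r e)) :
    (sList R (l ++ [e]) (E.s e) : LeavittPathAlgebra R E) =
      sList R l (E.r e) * gen R (Gen.edge e) := by
  have h' : E.IsPath (E.r e) [e] (E.s e) := ⟨rfl, rfl⟩
  rw [← sList_mul_sList h h', sList, sList, edge_mul_p]

/-! ### Monomials `s_λ s_{μ*}` span the algebra -/

variable (R E) in
/-- The `R`-span of the monomials `s_λ s_{μ*}` with `s(λ) = s(μ)` and `|μ| = n`. A monomial is indexed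
by the triple `(s(μ), λ, μ)`. -/
def monomialSpan (n : ℕ) : Submodule R (LeavittPathAlgebra R E) :=
  Submodule.span R ((fun k : V × List W × List W => sList R k.2.1 k.1 * sStarList R k.2.2 k.1) ''
    {k | (∃ u, E.IsPath u k.2.1 k.1) ∧ (∃ u, E.IsPath u k.2.2 k.1) ∧ k.2.2.length = n})

theorem monomial_mem {n : ℕ} {u u' w : V} {l m : List W} (hl : E.IsPath u l w)
    (hm : E.IsPath u' m w) (hn : m.length = n) :
    (sList R l w * sStarList R m w : LeavittPathAlgebra R E) ∈ monomialSpan R E n :=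
  Submodule.subset_span ⟨(w, l, m), ⟨⟨u, hl⟩, ⟨u', hm⟩, hn⟩, rfl⟩

/-- As `p_w` is the sum of the `s_e s_{e*}`, every monomial `s_λ s_{μ*}` is the sum of the monomials
`s_{λe} s_{(μe)*}`. -/
theorem monomialSpan_le_succ (hfin : E.RowFinite) (hsrc : E.NoSources) (n : ℕ) :
    monomialSpan R E n ≤ monomialSpan R E (n + 1) := by
  refine Submodule.span_le.2 ?_
  rintro _ ⟨⟨w, l, m⟩, ⟨⟨u, hl⟩, ⟨u', hm⟩, hn⟩, rfl⟩
  dsimp only at hl hm hn ⊢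
  rw [← sList_mul_p, p_eq_sum hfin hsrc w, Finset.mul_sum, Finset.sum_mul]
  refine Submodule.sum_mem _ fun e he => ?_
  obtain rfl : E.r e = w := by simpa [edgesInto] using he
  rw [← mul_assoc, mul_assoc, ← sStarList_append_singleton, ← sList_append_singleton e hl]
  exact monomial_mem (isPath_append.2 ⟨_, hl, rfl, rfl⟩) (isPath_append.2 ⟨_, hm, rfl, rfl⟩)
    (by simp [hn])

theorem monomialSpan_mono (hfin : E.RowFinite) (hsrc : E.NoSources) :
    Monotone (monomialSpan R E) :=
  monotone_nat_of_le_succ (monomialSpan_le_succ hfin hsrc)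

theorem gen_mul_monomial_mem {u u' w : V} {l m : List W} (hl : E.IsPath u l w)
    (hm : E.IsPath u' m w) (g : E.Gen) :
    gen R g * (sList R l w * sStarList R m w) ∈ ⨆ n, monomialSpan R E n := by
  have hmem : ∀ {u u' w : V} {l m : List W}, E.IsPath u l w → E.IsPath u' m w →
      (sList R l w * sStarList R m w : LeavittPathAlgebra R E) ∈ ⨆ n, monomialSpan R E n :=
    fun hl hm => Submodule.mem_iSup_of_mem _ (monomial_mem hl hm rfl)
  rw [← mul_assoc]
  cases g with
  | vertex v =>
    change p R v * _ * _ ∈ _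
    by_cases hv : v = u
    · rw [hv, p_mul_sList hl]
      exact hmem hl hm
    · rw [p_mul_sList_ne hl hv, zero_mul]
      exact zero_mem _
  | edge e =>
    by_cases he : E.s e = u
    · exact hmem (l := e :: l) (u := E.r e) ⟨rfl, he ▸ hl⟩ hm
    · rw [← edge_mul_p, mul_assoc (gen R _), p_mul_sList_ne hl he, mul_zero, zero_mul]
      exact zero_mem _
  | ghost e =>
    cases l with
    | nil =>
      obtain rfl : u = w := hl
      by_cases he : E.r e = u
      · subst he
        rw [sList, ghost_mul_p, ← sStarList_append_singleton, ← p_mul_sStarList]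
        exact hmem (l := []) rfl (isPath_append.2 ⟨_, hm, rfl, rfl⟩)
      · rw [← ghost_mul_p, mul_assoc (gen R _), sList, p_mul_p_ne he, mul_zero, zero_mul]
        exact zero_mem _
    | cons f l =>
      rw [sList, ← mul_assoc (gen R _)]
      by_cases he : e = f
      · rw [he, ghost_mul_edge, p_mul_sList hl.2]
        exact hmem hl.2 hm
      · rw [ghost_mul_edge_ne he, zero_mul, zero_mul]
        exact zero_mem _

theorem gen_mem_iSup_monomialSpan (g : E.Gen) : gen R g ∈ ⨆ n, monomialSpan R E n := by
  cases g with
  | vertex v =>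
    have h := gen_mul_monomial_mem (R := R) (E := E) (l := []) (m := []) (w := v) rfl rfl (Gen.vertex v)
    change p R v * (p R v * p R v) ∈ _ at h
    rwa [p_mul_p, p_mul_p] at h
  | edge e =>
    have h := gen_mul_monomial_mem (R := R) (E := E) (l := []) (m := []) (w := E.s e) rfl rfl
      (Gen.edge e)
    change _ * (p R _ * p R _) ∈ _ at h
    rwa [p_mul_p, edge_mul_p] at h
  | ghost e =>
    have h := gen_mul_monomial_mem (R := R) (E := E) (l := []) (m := []) (w := E.r e) rfl rfl
      (Gen.ghost e)
    change _ * (p R _ * p R _) ∈ _ at h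
    rwa [p_mul_p, ghost_mul_p] at h

theorem mem_iSup_monomialSpan (x : LeavittPathAlgebra R E) : x ∈ ⨆ n, monomialSpan R E n := by
  have hgen : ∀ g : E.Gen, ∀ y ∈ ⨆ n, monomialSpan R E n,
      gen R g * y ∈ ⨆ n, monomialSpan R E n := by
    intro g y hy
    refine Submodule.iSup_induction _ (motive := fun y => gen R g * y ∈ ⨆ n, monomialSpan R E n) hy
      (fun n y hy => ?_) (by simp) (fun y z hy hz => by rw [mul_add]; exact add_mem hy hz)
    induction hy using Submodule.span_induction with
    | mem y hy =>
      obtain ⟨⟨w, l, m⟩, ⟨⟨u, hl⟩, ⟨u', hm⟩, -⟩, rfl⟩ := hy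
      exact gen_mul_monomial_mem hl hm g
    | zero => simp
    | add y z _ _ hy hz => rw [mul_add]; exact add_mem hy hz
    | smul c y _ hy => rw [mul_smul_comm]; exact Submodule.smul_mem _ c hy
  -- The elements of the span that also multiply it into itself form a subalgebra.
  have main : ∀ (x : LeavittUnital R E) (hx : x ∈ NonUnitalAlgebra.adjoin R (Set.range (genU R E))),
      (⟨x, hx⟩ : LeavittPathAlgebra R E) ∈ ⨆ n, monomialSpan R E n ∧
        ∀ y ∈ ⨆ n, monomialSpan R E n,
          (⟨x, hx⟩ : LeavittPathAlgebra R E) * y ∈ ⨆ n, monomialSpan R E n := by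
    intro x hx
    induction hx using NonUnitalAlgebra.adjoin_induction with
    | mem x hx =>
      obtain ⟨g, rfl⟩ := hx
      exact ⟨gen_mem_iSup_monomialSpan g, hgen g⟩
    | add x y hx' hy' hx hy =>
      refine ⟨add_mem hx.1 hy.1, fun z hz => ?_⟩
      have := add_mem (hx.2 z hz) (hy.2 z hz)
      rwa [← add_mul] at this
    | zero =>
      refine ⟨zero_mem _, fun z _ => ?_⟩
      have : (0 : LeavittPathAlgebra R E) * z ∈ ⨆ n, monomialSpan R E n := by simp
      exact this
    | mul x y hx' hy' hx hy =>
      refine ⟨hx.2 _ hy.1, fun z hz => ?_⟩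
      have := hx.2 _ (hy.2 z hz)
      rwa [← mul_assoc] at this
    | smul c x hx' hx =>
      refine ⟨Submodule.smul_mem _ c hx.1, fun z hz => ?_⟩
      have := Submodule.smul_mem _ c (hx.2 z hz)
      rwa [← smul_mul_assoc] at this
  exact (main x.1 x.2).1

theorem exists_mem_monomialSpan (hfin : E.RowFinite) (hsrc : E.NoSources)
    (x : LeavittPathAlgebra R E) : ∃ n, x ∈ monomialSpan R E n :=
  (Submodule.mem_iSup_of_directed _ (monomialSpan_mono hfin hsrc).directed_le).1
    (mem_iSup_monomialSpan x)

end Calculus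

section Reduction

variable {V W : Type*} {R : Type*} [CommRing R] {E : DirectedGraph V W}

/-! ### Coefficients of elements of an ideal -/

/-- `x` is zero or a scalar multiple of `s_β` for a closed path `β` of positive length at `v`. -/
def IsClosedTerm (v : V) (x : LeavittPathAlgebra R E) : Prop :=
  x = 0 ∨ ∃ (c : R) (b : List W), b ≠ [] ∧ E.IsPath v b v ∧ x = c • sList R b v

/-- Conjugation by a closed path `g` at `v`: `s_{g*} s_β s_g` is `s_{β'}` with `|β'| = |β|` if
`β g = g β'`, and zero if `β g` does not begin with `g`. -/
theorem isClosedTerm_conj {v : V} {g : List W} (hg : E.IsPath v g v)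
    {x : LeavittPathAlgebra R E} (hx : IsClosedTerm v x) :
    IsClosedTerm v (sStarList R g v * x * sList R g v) := by
  obtain rfl | ⟨c, b, hb, hp, rfl⟩ := hx
  · left; simp
  have hconj : (sStarList R g v : LeavittPathAlgebra R E) * (c • sList R b v) * sList R g v =
      c • (sStarList R g v * sList R (b ++ g) v) := by
    rw [mul_smul_comm, smul_mul_assoc, mul_assoc, sList_mul_sList hp hg]
  rw [hconj]
  have hbg : E.IsPath v (b ++ g) v := isPath_append.2 ⟨v, hp, hg⟩
  by_cases hpre : g <+: b ++ g
  · obtain ⟨b', hb'⟩ := hpre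
    rw [← hb'] at hbg ⊢
    obtain ⟨x, hx, hx'⟩ := isPath_append.1 hbg
    have hlen : b'.length = b.length := by
      have := congrArg List.length hb'
      simp only [List.length_append] at this
      omega
    have hb0 : b' ≠ [] := by
      rintro rfl
      exact hb (List.length_eq_zero_iff.1 hlen.symm)
    have hxv : x = v := by
      by_cases hg0 : g = []
      · subst hg0
        exact Eq.symm hx
      · exact hx.source_unique hg0 hg
    subst hxv
    exact Or.inr ⟨c, b', hb0, hx', by rw [sStarList_mul_sList_append hg hx']⟩
  · left
    rw [sStarList_mul_sList_of_not_prefix v hbg (by simp) hpre, smul_zero]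

/-- Closed paths can be removed from an element of an ideal: conjugation by a suitable closed path
kills one of them, keeps the vertex term, and turns the others into closed terms. -/
theorem smul_p_mem_of_add_closed (hK : E.ConditionK) {ι : Type*} (v : V)
    (I : TwoSidedIdeal (LeavittPathAlgebra R E)) (r : R) (S : Finset ι) :
    ∀ y : ι → LeavittPathAlgebra R E, (∀ i ∈ S, IsClosedTerm v (y i)) →
      r • p R v + ∑ i ∈ S, y i ∈ I → r • p R v ∈ I := by
  classical
  induction S using Finset.induction with
  | empty => intro y _ h; simpa using h
  | insert i S hi ih =>
    intro y hy h
    rw [Finset.sum_insert hi] at h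
    have hyS : ∀ j ∈ S, IsClosedTerm v (y j) := fun j hj => hy j (Finset.mem_insert_of_mem hj)
    obtain h0 | ⟨c, b, hb, hp, hyi⟩ := hy i (Finset.mem_insert_self i S)
    · rw [h0, zero_add] at h
      exact ih y hyS h
    obtain ⟨g, hg, hpre⟩ := hK.exists_not_prefix hb hp
    refine ih (fun j => sStarList R g v * y j * sList R g v)
      (fun j hj => isClosedTerm_conj hg (hyS j hj)) ?_
    have hkill : sStarList R g v * y i * sList R g v = 0 := by
      rw [hyi, mul_smul_comm, smul_mul_assoc, mul_assoc, sList_mul_sList hp hg,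
        sStarList_mul_sList_of_not_prefix v (isPath_append.2 ⟨v, hp, hg⟩) (by simp) hpre, smul_zero]
    have hkeep : (sStarList R g v : LeavittPathAlgebra R E) * (r • p R v) * sList R g v = r • p R v := by
      rw [mul_smul_comm, smul_mul_assoc, sStarList_mul_p hg, sStarList_mul_sList_self hg]
    have hmem := I.mul_mem_right _ (sList R g v) (I.mul_mem_left (sStarList R g v) _ h)
    rwa [mul_add, mul_add, add_mul, add_mul, hkill, hkeep, zero_add, Finset.mul_sum,
      Finset.sum_mul] at hmem

/-- If a combination of the elements `s_λ`, for distinct paths `λ` with source `v`, lies in `I`, then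
so does each coefficient times `p_v`. A path of minimal length is dealt with first: multiplication by
`s_{λ*}` turns the other terms into closed ones. -/
theorem smul_p_mem_of_sum_mem (hK : E.ConditionK) {ι : Type*} (v : V)
    (I : TwoSidedIdeal (LeavittPathAlgebra R E)) (c : ι → R) (l : ι → List W) (S : Finset ι)
    (hinj : Set.InjOn l S) (hp : ∀ i ∈ S, ∃ u, E.IsPath u (l i) v)
    (h : ∑ i ∈ S, c i • (sList R (l i) v : LeavittPathAlgebra R E) ∈ I) :
    ∀ i ∈ S, c i • p R v ∈ I := by
  classical
  induction S using Finset.strongInduction with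
  | H S ih =>
    intro i hi
    obtain ⟨k, hk, hmin⟩ := S.exists_min_image (fun i => (l i).length) ⟨i, hi⟩
    obtain ⟨u, hu⟩ := hp k hk
    have hsplit := Finset.add_sum_erase S
      (fun i => c i • (sList R (l i) v : LeavittPathAlgebra R E)) hk
    have hck : c k • p R v ∈ I := by
      refine smul_p_mem_of_add_closed hK v I (c k) (S.erase k)
        (fun j => sStarList R (l k) v * (c j • sList R (l j) v)) (fun j hj => ?_) ?_
      · obtain ⟨hjk, hjS⟩ := Finset.mem_erase.1 hj
        obtain ⟨u', hu'⟩ := hp j hjS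
        rw [mul_smul_comm]
        by_cases hpre : l k <+: l j
        · obtain ⟨b, hb⟩ := hpre
          rw [← hb] at hu' ⊢
          obtain ⟨x, hx, hxb⟩ := isPath_append.1 hu'
          have hb0 : b ≠ [] := by
            rintro rfl
            rw [List.append_nil] at hb
            exact hjk (hinj hjS hk hb.symm)
          by_cases hxv : x = v
          · subst hxv
            exact Or.inr ⟨c j, b, hb0, hxb, by rw [sStarList_mul_sList_append hx hxb]⟩
          · left
            -- Here `λ` is the vertex `v`, and the other path has a range different from `v`.
            by_cases hk0 : l k = []
            · rw [hk0, List.nil_append, sStarList, p_mul_sList_ne hxb (Ne.symm hxv), smul_zero]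
            · exact absurd (hx.source_unique hk0 hu) hxv
        · left
          rw [sStarList_mul_sList_of_not_prefix v hu' (hmin j hjS) hpre, smul_zero]
      · have := I.mul_mem_left (sStarList R (l k) v) _ h
        rwa [← hsplit, mul_add, mul_smul_comm, sStarList_mul_sList_self hu, Finset.mul_sum] at this
    by_cases hik : i = k
    · rwa [hik]
    refine ih (S.erase k) (Finset.erase_ssubset hk)
      (hinj.mono (by simp))
      (fun j hj => hp j (Finset.mem_of_mem_erase hj)) ?_ i (Finset.mem_erase.2 ⟨hik, hi⟩)
    have hterm : c k • (sList R (l k) v : LeavittPathAlgebra R E) ∈ I := by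
      rw [← sList_mul_p, ← mul_smul_comm]
      exact I.mul_mem_left _ _ hck
    exact (add_mem_cancel_left hterm).1 (hsplit ▸ h)

/-- The largest `R`-submodule inside the ideal `I`. A two-sided ideal of a non-unital ring is closed under
the ring operations only, so membership in `I` has to be checked together with all scalar multiples when
a linear span is compared with `I`. -/
def scalarCore (I : TwoSidedIdeal (LeavittPathAlgebra R E)) :
    Submodule R (LeavittPathAlgebra R E) where
  carrier := {x | ∀ c : R, c • x ∈ I}
  zero_mem' c := by rw [smul_zero]; exact I.zero_mem
  add_mem' hx hy c := by rw [smul_add]; exact I.add_mem (hx c) (hy c)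
  smul_mem' a x hx c := by rw [smul_smul]; exact hx _

theorem scalarCore_le (I : TwoSidedIdeal (LeavittPathAlgebra R E)) {x : LeavittPathAlgebra R E}
    (hx : x ∈ scalarCore I) : x ∈ I := by
  simpa using hx 1

theorem smul_smul_p_mem {I : TwoSidedIdeal (LeavittPathAlgebra R E)} {a : R} {v : V}
    (h : a • p R v ∈ I) (c : R) : (c * a) • p R v ∈ I := by
  have := I.mul_mem_left (c • p R v) _ h
  rwa [smul_mul_smul_comm, p_mul_p] at this

theorem smul_sPath_mul_sStarPath_mem {I : TwoSidedIdeal (LeavittPathAlgebra R E)} {a : R} {l m : E.Path}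
    (h : a • p R m.source ∈ I) : a • (sPath R l * sStarPath R m) ∈ I := by
  have h' := I.mul_mem_left (sPath R l) _ (I.mul_mem_right _ (sStarPath R m) h)
  rwa [smul_mul_assoc, sStarPath, p_mul_sStarList, mul_smul_comm] at h'

theorem idealSpan_subset {I : TwoSidedIdeal (LeavittPathAlgebra R E)}
    {x : LeavittPathAlgebra R E} (hx : x ∈ idealSpan I) : x ∈ I := by
  refine scalarCore_le I (Submodule.span_le.2 ?_ hx)
  rintro _ ⟨a, l, m, h, rfl⟩ c
  rw [smul_smul]
  exact smul_sPath_mul_sStarPath_mem (smul_smul_p_mem h c)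

/-- An element `x` of an ideal is a combination of monomials `s_λ s_{μ*}` with all `μ` of one length, so
`x s_μ` is a combination of elements `s_λ`, with the same coefficients, and `smul_p_mem_of_sum_mem`
applies. -/
theorem mem_idealSpan (hfin : E.RowFinite) (hsrc : E.NoSources) (hK : E.ConditionK)
    {I : TwoSidedIdeal (LeavittPathAlgebra R E)} {x : LeavittPathAlgebra R E} (hx : x ∈ I) :
    x ∈ idealSpan I := by
  classical
  obtain ⟨n, hn⟩ := exists_mem_monomialSpan hfin hsrc x
  obtain ⟨F, hF, rfl⟩ := (Finsupp.mem_span_image_iff_linearCombination R).1 hn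
  rw [Finsupp.mem_supported] at hF
  rw [Finsupp.linearCombination_apply, Finsupp.sum] at hx ⊢
  refine Submodule.sum_mem _ fun k hk => ?_
  obtain ⟨w, l, m⟩ := k
  obtain ⟨⟨u, hl⟩, ⟨u', hm⟩, hmn⟩ := hF hk
  dsimp only at hl hm hmn
  refine Submodule.subset_span ⟨F (w, l, m), ⟨l, u, w, hl⟩, ⟨m, u', w, hm⟩, ?_, rfl⟩
  -- Multiplication by `s_μ` isolates the terms `s_λ s_{μ*}` with this `μ`.
  have hx' := I.mul_mem_right _ (sList R m w) hx
  rw [Finset.sum_mul] at hx'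
  have hterm : ∀ k ∈ F.support, (F k • (sList R k.2.1 k.1 * sStarList R k.2.2 k.1) * sList R m w :
      LeavittPathAlgebra R E) =
      if k.1 = w ∧ k.2.2 = m then F k • sList R k.2.1 w else 0 := by
    rintro ⟨w₁, l₁, m₁⟩ hk₁
    obtain ⟨⟨u₁, hl₁⟩, ⟨u₁', hm₁⟩, hmn₁⟩ := hF hk₁
    dsimp only at hl₁ hm₁ hmn₁ ⊢
    rw [smul_mul_assoc, mul_assoc]
    by_cases hmm : m₁ = m
    · subst hmm
      by_cases hw : w₁ = w
      · subst hw
        rw [if_pos ⟨rfl, rfl⟩, sStarList_mul_sList_self hm, sList_mul_p]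
      · rw [if_neg fun h => hw h.1]
        by_cases hm0 : m₁ = []
        · rw [hm0, sStarList, sList, p_mul_p_ne hw, mul_zero, smul_zero]
        · exact absurd (hm₁.source_unique hm0 hm) hw
    · rw [if_neg fun h => hmm h.2, sStarList_mul_sList_of_not_prefix _ hm (by omega), mul_zero,
        smul_zero]
      exact fun h => hmm (h.eq_of_length (by omega))
  rw [Finset.sum_congr rfl hterm, ← Finset.sum_filter] at hx'
  refine smul_p_mem_of_sum_mem hK w I F (fun k => k.2.1) _ ?_ ?_ hx' (w, l, m)
    (Finset.mem_filter.2 ⟨hk, rfl, rfl⟩)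
  · rintro ⟨w₁, l₁, m₁⟩ h₁ ⟨w₂, l₂, m₂⟩ h₂ h
    obtain ⟨-, rfl, rfl⟩ := Finset.mem_filter.1 (Finset.mem_coe.1 h₁)
    obtain ⟨-, hw, hm₂⟩ := Finset.mem_filter.1 (Finset.mem_coe.1 h₂)
    dsimp only at h hw hm₂
    rw [h, hw, hm₂]
  · rintro ⟨w₁, l₁, m₁⟩ h₁
    obtain ⟨hk₁, rfl, rfl⟩ := Finset.mem_filter.1 h₁
    exact (hF hk₁).1

theorem coe_eq_idealSpan (hfin : E.RowFinite) (hsrc : E.NoSources) (hK : E.ConditionK)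
    (I : TwoSidedIdeal (LeavittPathAlgebra R E)) :
    (I : Set (LeavittPathAlgebra R E)) = idealSpan I :=
  Set.Subset.antisymm (fun _ => mem_idealSpan hfin hsrc hK) fun _ => idealSpan_subset

end Reduction

section Representation

variable {V W : Type*} (R : Type*) [CommRing R] (E : DirectedGraph V W)

/-! ### Representations on functions on infinite paths -/

/-- A set of infinite paths of `E` that is closed under removing the first edge and under prepending
an edge, axiomatised by the operations `head`, `tail` and `cons`. -/
structure PathSpace (X : Type*) where
  /-- the first edge of an infinite path -/
  head : X → W
  /-- the path without its first edge -/
  tail : X → X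
  /-- the path `e x`, if `e x` is a path -/
  cons : ∀ (e : W) (x : X), E.r (head x) = E.s e → X
  range_tail : ∀ x, E.r (head (tail x)) = E.s (head x)
  head_cons : ∀ e x h, head (cons e x h) = e
  tail_cons : ∀ e x h, tail (cons e x h) = x
  cons_head_tail : ∀ x, cons (head x) (tail x) (range_tail x) = x

namespace PathSpace

variable {E} {X : Type*} (P : E.PathSpace X) (M : Type*) [AddCommGroup M] [Module R M]

open Classical in
/-- `p_v` acts by restricting a function to the infinite paths with range `v`. -/
noncomputable def vertexEnd (v : V) : Module.End R (X → M) where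
  toFun f x := if E.r (P.head x) = v then f x else 0
  map_add' f g := by ext x; by_cases h : E.r (P.head x) = v <;> simp [h]
  map_smul' c f := by ext x; by_cases h : E.r (P.head x) = v <;> simp [h]

open Classical in
/-- `s_e` acts by moving the value at `x` to `e x`. -/
noncomputable def edgeEnd (e : W) : Module.End R (X → M) where
  toFun f x := if P.head x = e then f (P.tail x) else 0
  map_add' f g := by ext x; by_cases h : P.head x = e <;> simp [h]
  map_smul' c f := by ext x; by_cases h : P.head x = e <;> simp [h]

open Classical in
/-- `s_{e*}` acts by moving the value at `e x` to `x`. -/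
noncomputable def ghostEnd (e : W) : Module.End R (X → M) where
  toFun f x := if h : E.r (P.head x) = E.s e then f (P.cons e x h) else 0
  map_add' f g := by ext x; by_cases h : E.r (P.head x) = E.s e <;> simp [h]
  map_smul' c f := by ext x; by_cases h : E.r (P.head x) = E.s e <;> simp [h]

theorem isLeavittFamily :
    E.IsLeavittFamily (P.vertexEnd R M) (P.edgeEnd R M) (P.ghostEnd R M) := by
  constructor
  · intro v
    ext f x
    by_cases h : E.r (P.head x) = v <;> simp [vertexEnd, h]
  · intro v w hvw
    ext f x
    by_cases h : E.r (P.head x) = v <;> simp [vertexEnd, h, hvw]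
  · intro e
    ext f x
    by_cases h : P.head x = e <;> simp [vertexEnd, edgeEnd, h]
  · intro e
    ext f x
    by_cases h : P.head x = e
    · subst h
      simp [vertexEnd, edgeEnd, P.range_tail]
    · simp [vertexEnd, edgeEnd, h]
  · intro e
    ext f x
    by_cases h : E.r (P.head x) = E.s e <;> simp [vertexEnd, ghostEnd, h]
  · intro e
    ext f x
    by_cases h : E.r (P.head x) = E.s e <;> simp [vertexEnd, ghostEnd, h, P.head_cons]
  · intro e
    ext f x
    by_cases h : E.r (P.head x) = E.s e <;>
      simp [vertexEnd, edgeEnd, ghostEnd, h, P.head_cons, P.tail_cons]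
  · intro e f hef
    ext g x
    by_cases h : E.r (P.head x) = E.s e <;> simp [edgeEnd, ghostEnd, h, P.head_cons, hef]
  · intro v h _
    ext f x
    rw [LinearMap.sum_apply, Finset.sum_apply]
    by_cases hv : E.r (P.head x) = v
    · rw [Finset.sum_eq_single_of_mem (P.head x) (by simpa [edgesInto] using hv)]
      · simp [vertexEnd, edgeEnd, ghostEnd, hv, P.range_tail, P.cons_head_tail]
      · intro e _ he
        simp [edgeEnd, Ne.symm he]
    · rw [Finset.sum_eq_zero]
      · simp [vertexEnd, hv]
      · intro e he
        have hne : P.head x ≠ e := by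
          rintro rfl
          exact hv (by simpa [edgesInto] using he)
        simp [edgeEnd, hne]

end PathSpace

variable {R E}

/-- The infinite paths `x = x₀ x₁ ⋯` such that, for every `b`, the path `x` meets `K b` if and only if
`b ∈ J`. -/
def AdaptedPath (E : DirectedGraph V W) (K : R → Set V) (J : Ideal R) : Type _ :=
  {x : ℕ → W // (∀ n, E.s (x n) = E.r (x (n + 1))) ∧ ∀ b, (∃ n, E.r (x n) ∈ K b) ↔ b ∈ J}

/-- If the sets `K b` are hereditary, then whether a path meets `K b` depends only on its tails. -/
noncomputable def adaptedPathSpace {K : R → Set V} (hher : ∀ b, E.Hereditary (K b)) (J : Ideal R) :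
    E.PathSpace (AdaptedPath E K J) where
  head x := x.1 0
  tail x := ⟨fun n => x.1 (n + 1), fun n => x.2.1 (n + 1), fun b => by
    rw [← x.2.2 b]
    constructor
    · rintro ⟨n, hn⟩
      exact ⟨n + 1, hn⟩
    · rintro ⟨n, hn⟩
      exact ⟨n, by rw [← x.2.1 n]; exact hher b _ hn⟩⟩
  cons e x h := ⟨fun n => Nat.casesOn n e x.1, by
    constructor
    · rintro (_ | n)
      · exact h.symm
      · exact x.2.1 n
    · intro b
      rw [← x.2.2 b]
      constructor
      · rintro ⟨_ | n, hn⟩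
        · exact ⟨0, by rw [h]; exact hher b _ hn⟩
        · exact ⟨n, hn⟩
      · rintro ⟨n, hn⟩
        exact ⟨n + 1, hn⟩⟩
  range_tail x := (x.2.1 0).symm
  head_cons _ _ _ := rfl
  tail_cons _ _ _ := rfl
  cons_head_tail x := by
    apply Subtype.ext
    funext n
    cases n <;> rfl

/-- Outside a saturated set there is an infinite path. -/
theorem Saturated.exists_path {H : Set V} (hH : E.Saturated H) {w : V} (hw : w ∉ H) :
    ∃ x : ℕ → W, E.r (x 0) = w ∧ (∀ n, E.s (x n) = E.r (x (n + 1))) ∧ ∀ n, E.r (x n) ∉ H := by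
  have step : ∀ v : {v // v ∉ H}, ∃ e, E.r e = v.1 ∧ E.s e ∉ H := by
    rintro ⟨v, hv⟩
    by_contra! hall
    refine hv (hH v ?_)
    rintro _ ⟨e, he, rfl⟩
    exact hall e he
  choose next hr hs using step
  let vert : ℕ → {v // v ∉ H} := fun n => Nat.rec ⟨w, hw⟩ (fun _ v => ⟨E.s (next v), hs v⟩) n
  exact ⟨fun n => next (vert n), hr _, fun n => (hr (vert (n + 1))).symm,
    fun n => by rw [hr]; exact (vert n).2⟩

theorem map_eq_zero_of_mem_span {A B : Type*} [NonUnitalNonAssocRing A] [NonUnitalNonAssocRing B]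
    (f : A →ₙ+* B) {S : Set A} (hS : ∀ x ∈ S, f x = 0) {x : A} (hx : x ∈ TwoSidedIdeal.span S) :
    f x = 0 := by
  have hle : TwoSidedIdeal.span S ≤ TwoSidedIdeal.ker f :=
    TwoSidedIdeal.span_le.2 fun y hy => (TwoSidedIdeal.mem_ker f).2 (hS y hy)
  exact (TwoSidedIdeal.mem_ker f).1 (hle hx)

/-- The ideal generated by the elements `b p_u` with `u ∈ K b` contains no other multiples of the
vertex idempotents. If `w ∉ K a`, choose an infinite path `ξ` from `w` outside `K a`, let `J` be the
ideal of all `b` such that `ξ` meets `K b`, and let `L_R(E)` act on the `R ⧸ J`-valued functions on the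
paths that meet the same sets `K b` as `ξ`: the generators of the ideal act as zero, and `a p_w` does
not, as `a ∉ J`. -/
theorem mem_of_smul_p_mem_span {K : R → Set V} (hsat : ∀ b, E.Saturated (K b))
    (hher : ∀ b, E.Hereditary (K b)) (hzero : K 0 = Set.univ)
    (hadd : ∀ b c, K b ∩ K c ⊆ K (b + c)) (hmul : ∀ r b, K b ⊆ K (r * b)) {a : R} {w : V}
    (h : (a • p R w : LeavittPathAlgebra R E) ∈
      TwoSidedIdeal.span {x | ∃ b u, u ∈ K b ∧ x = b • p R u}) : w ∈ K a := by
  by_contra hw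
  obtain ⟨ξ, hξ0, hξ, hξK⟩ := (hsat a).exists_path hw
  have hstay : ∀ b m n, m ≤ n → E.r (ξ m) ∈ K b → E.r (ξ n) ∈ K b := by
    intro b m n hmn hm
    induction n, hmn using Nat.le_induction with
    | base => exact hm
    | succ n _ ih => rw [← hξ]; exact hher b _ ih
  let J : Ideal R :=
    { carrier := {b | ∃ n, E.r (ξ n) ∈ K b}
      zero_mem' := ⟨0, by rw [hzero]; trivial⟩
      add_mem' := by
        rintro b c ⟨m, hm⟩ ⟨n, hn⟩
        exact ⟨max m n, hadd b c ⟨hstay b _ _ (le_max_left m n) hm,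
          hstay c _ _ (le_max_right m n) hn⟩⟩
      smul_mem' := by
        rintro r b ⟨n, hn⟩
        exact ⟨n, hmul r b hn⟩ }
  have haJ : a ∉ J := fun ⟨n, hn⟩ => hξK n hn
  let x : AdaptedPath E K J := ⟨ξ, hξ, fun b => Iff.rfl⟩
  let P := adaptedPathSpace hher J
  obtain ⟨φ, ⟨hφ, -⟩, -⟩ := leavitt_universal R (P.isLeavittFamily R (R ⧸ J))
  let ψ : LeavittPathAlgebra R E →ₙ+* Module.End R (AdaptedPath E K J → R ⧸ J) :=
    { toFun := φ
      map_mul' := fun y z => map_mul φ y z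
      map_zero' := map_zero φ
      map_add' := fun y z => map_add φ y z }
  have hψ : ∀ b u, ψ (b • p R u) = b • P.vertexEnd R (R ⧸ J) u := fun b u =>
    (map_smul φ b (p R u)).trans (by rw [hφ])
  have hker : ψ (a • p R w) = 0 := by
    refine map_eq_zero_of_mem_span ψ ?_ h
    rintro _ ⟨b, u, hu, rfl⟩
    refine (hψ b u).trans ?_
    ext f y
    by_cases hy : E.r (P.head y) = u
    · have hb : b ∈ J := (y.2.2 b).1 ⟨0, by rw [← hy] at hu; exact hu⟩
      obtain ⟨c, hc⟩ := Ideal.Quotient.mk_surjective (f y)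
      have : b • Ideal.Quotient.mk J c = 0 := by
        rw [← Ideal.Quotient.mk_eq_mk, ← Submodule.Quotient.mk_smul,
          Submodule.Quotient.mk_eq_zero]
        exact J.mul_mem_right c hb
      simp [PathSpace.vertexEnd, hy, ← hc, this]
    · simp [PathSpace.vertexEnd, hy]
  rw [hψ] at hker
  have hval := congrFun (LinearMap.congr_fun hker (fun _ => Ideal.Quotient.mk J 1)) x
  have hx : E.r (P.head x) = w := hξ0
  have hval' : a • Ideal.Quotient.mk J 1 = 0 := by
    simpa [PathSpace.vertexEnd, hx] using hval
  rw [← Ideal.Quotient.mk_eq_mk, ← Submodule.Quotient.mk_smul,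
    Submodule.Quotient.mk_eq_zero, smul_eq_mul, mul_one] at hval'
  exact haJ hval'

end Representation

section Lattice

variable {V W : Type*} {R : Type*} [CommRing R] {E : DirectedGraph V W}

/-! ### Ideals and functions on saturated hereditary sets -/

theorem SatHer.subset_join {A : Set E.SatHer} {H : E.SatHer} (hH : H ∈ A) :
    H.1 ⊆ (SatHer.join A).1 :=
  Set.subset_iInter₂ fun _ hK => hK H hH

theorem SatHer.join_subset {A : Set E.SatHer} {K : E.SatHer} (hK : ∀ H ∈ A, H.1 ⊆ K.1) :
    (SatHer.join A).1 ⊆ K.1 :=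
  Set.biInter_subset_of_mem hK

/-- The intersection of two saturated hereditary sets. -/
def SatHer.inter (H K : E.SatHer) : E.SatHer :=
  ⟨H.1 ∩ K.1, fun v hv => ⟨H.2.1 v (hv.trans Set.inter_subset_left),
    K.2.1 v (hv.trans Set.inter_subset_right)⟩, fun e he => ⟨H.2.2 e he.1, K.2.2 e he.2⟩⟩

/-- The set of all vertices, as a saturated hereditary set. -/
def SatHer.univ : E.SatHer := ⟨Set.univ, fun _ _ => trivial, fun _ _ => trivial⟩

theorem IdealFun.antitone (π : IdealFun R E) {H K : E.SatHer} (h : H.1 ⊆ K.1) :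
    π.1 K ≤ π.1 H := by
  have hjoin : SatHer.join {H, K} = K := by
    refine Subtype.ext (Set.Subset.antisymm (SatHer.join_subset ?_) (SatHer.subset_join (by simp)))
    rintro L (rfl | rfl)
    · exact h
    · exact subset_rfl
  have := π.2 {H, K}
  rw [hjoin] at this
  rw [this]
  exact iInf₂_le H (by simp)

/-- The largest saturated hereditary set `H` with `a ∈ π H`. -/
def IdealFun.level (π : IdealFun R E) (a : R) : E.SatHer :=
  SatHer.join {H | a ∈ π.1 H}

theorem IdealFun.mem_level (π : IdealFun R E) (a : R) : a ∈ π.1 (π.level a) := by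
  rw [IdealFun.level, π.2]
  simp only [Submodule.mem_iInf]
  exact fun H hH => hH

theorem IdealFun.mem_iff_subset_level (π : IdealFun R E) {a : R} {H : E.SatHer} :
    a ∈ π.1 H ↔ H.1 ⊆ (π.level a).1 :=
  ⟨fun h => SatHer.subset_join h, fun h => π.antitone h (π.mem_level a)⟩

/-- The ideal of `L_R(E)` attached to `π`, generated by the `a p_v` with `v ∈ H` and `a ∈ π H` for
some `H`, in other words with `v` in the level set of `a`. -/
def gammaIdeal (π : IdealFun R E) : TwoSidedIdeal (LeavittPathAlgebra R E) :=
  TwoSidedIdeal.span {x | ∃ a v, v ∈ (π.level a).1 ∧ x = a • p R v}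

theorem smul_p_mem_gammaIdeal (π : IdealFun R E) {a : R} {v : V} :
    a • p R v ∈ gammaIdeal π ↔ v ∈ (π.level a).1 := by
  refine ⟨fun h => ?_, fun h => TwoSidedIdeal.subset_span ⟨a, v, h, rfl⟩⟩
  refine mem_of_smul_p_mem_span (K := fun a => (π.level a).1) (fun b => (π.level b).2.1)
    (fun b => (π.level b).2.2) ?_ (fun b c => ?_) (fun r b => ?_) h
  · exact Set.univ_subset_iff.1 (π.mem_iff_subset_level (H := SatHer.univ).1 (zero_mem _))
  · refine π.mem_iff_subset_level (H := (π.level b).inter (π.level c)).1 (add_mem ?_ ?_)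
    · exact π.antitone Set.inter_subset_left (π.mem_level b)
    · exact π.antitone Set.inter_subset_right (π.mem_level c)
  · exact π.mem_iff_subset_level.1 (Ideal.mul_mem_left _ r (π.mem_level b))

/-- The elements that `a` multiplies into the ideal `I`. -/
def scalarColon (I : TwoSidedIdeal (LeavittPathAlgebra R E)) (a : R) :
    TwoSidedIdeal (LeavittPathAlgebra R E) :=
  TwoSidedIdeal.mk' {x | a • x ∈ I} (by simp)
    (fun {x y} hx hy => by
      change a • (x + y) ∈ I
      rw [smul_add]
      exact I.add_mem hx hy)
    (fun {x} hx => by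
      exact (congrArg (· ∈ I) (smul_neg a x)).mpr (I.neg_mem hx))
    (fun {x y} hy => by
      change a • (x * y) ∈ I
      rw [← mul_smul_comm]
      exact I.mul_mem_left _ _ hy)
    (fun {x y} hx => by
      change a • (x * y) ∈ I
      rw [← smul_mul_assoc]
      exact I.mul_mem_right _ _ hx)

theorem mem_scalarColon {I : TwoSidedIdeal (LeavittPathAlgebra R E)} {a : R}
    {x : LeavittPathAlgebra R E} : x ∈ scalarColon I a ↔ a • x ∈ I :=
  TwoSidedIdeal.mem_mk' _ _ _ _ _ _ _

theorem smul_mem_gammaIdeal (π : IdealFun R E) {a : R} {H : E.SatHer} (ha : a ∈ π.1 H)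
    {x : LeavittPathAlgebra R E} (hx : x ∈ idealOf R H) : a • x ∈ gammaIdeal π := by
  have hle : idealOf R H ≤ scalarColon (gammaIdeal π) a := by
    rw [idealOf, TwoSidedIdeal.span_le]
    rintro _ ⟨v, hv, rfl⟩
    exact mem_scalarColon.2 ((smul_p_mem_gammaIdeal π).2 (π.mem_iff_subset_level.1 ha hv))
  exact mem_scalarColon.1 (hle hx)

theorem coe_gammaIdeal (hfin : E.RowFinite) (hsrc : E.NoSources) (hK : E.ConditionK)
    (π : IdealFun R E) :
    (gammaIdeal π : Set (LeavittPathAlgebra R E)) = gammaSpan π := by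
  apply Set.Subset.antisymm
  · intro x hx
    refine Submodule.span_mono ?_ (mem_idealSpan hfin hsrc hK hx)
    rintro _ ⟨a, l, m, h, rfl⟩
    refine ⟨a, l, m, ⟨π.level a, π.mem_level a, ?_⟩, rfl⟩
    have hp : p R m.source ∈ idealOf R (π.level a) :=
      TwoSidedIdeal.subset_span ⟨_, (smul_p_mem_gammaIdeal π).1 h, rfl⟩
    have := (idealOf R (π.level a)).mul_mem_left (sPath R l) _
      ((idealOf R (π.level a)).mul_mem_right _ (sStarPath R m) hp)
    rwa [sStarPath, p_mul_sStarList] at this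
  · intro x hx
    refine scalarCore_le _ (Submodule.span_le.2 ?_ hx)
    rintro _ ⟨a, l, m, ⟨H, ha, h⟩, rfl⟩ c
    rw [smul_smul]
    exact smul_mem_gammaIdeal π (Ideal.mul_mem_left _ c ha) h

theorem gammaIdeal_le_iff (π₁ π₂ : IdealFun R E) :
    gammaIdeal π₁ ≤ gammaIdeal π₂ ↔ ∀ H : E.SatHer, π₁.1 H ≤ π₂.1 H := by
  constructor
  · intro h H a ha
    refine π₂.mem_iff_subset_level.2 fun v hv => (smul_p_mem_gammaIdeal π₂).1 (h ?_)
    exact (smul_p_mem_gammaIdeal π₁).2 (π₁.mem_iff_subset_level.1 ha hv)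
  · intro h
    refine TwoSidedIdeal.span_mono ?_
    rintro _ ⟨a, v, hv, rfl⟩
    exact ⟨a, v, π₂.mem_iff_subset_level.1 (h _ (π₁.mem_level a)) hv, rfl⟩

/-- The vertices `v` with `a p_v ∈ I` form a saturated hereditary set. -/
def idealLevel (hfin : E.RowFinite) (hsrc : E.NoSources)
    (I : TwoSidedIdeal (LeavittPathAlgebra R E)) (a : R) : E.SatHer :=
  ⟨{v | a • p R v ∈ I}, by
    constructor
    · intro v hv
      change a • p R v ∈ I
      rw [p_eq_sum hfin hsrc v, Finset.smul_sum]
      refine sum_mem fun e he => ?_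
      have hs : a • p R (E.s e) ∈ I := hv ⟨e, by simpa using he, rfl⟩
      have := I.mul_mem_left (gen R (Gen.edge e)) _ (I.mul_mem_right _ (gen R (Gen.ghost e)) hs)
      rwa [smul_mul_assoc, p_mul_ghost, mul_smul_comm] at this
    · intro e he
      change a • p R (E.s e) ∈ I
      have := I.mul_mem_left (gen R (Gen.ghost e)) _
        (I.mul_mem_right _ (gen R (Gen.edge e)) (show a • p R (E.r e) ∈ I from he))
      rwa [smul_mul_assoc, p_mul_edge, mul_smul_comm, ghost_mul_edge] at this⟩

/-- The function `H ↦ {a : a p_v ∈ I for all v ∈ H}` attached to an ideal `I`. -/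
def idealFunOf (hfin : E.RowFinite) (hsrc : E.NoSources)
    (I : TwoSidedIdeal (LeavittPathAlgebra R E)) : IdealFun R E :=
  ⟨fun H =>
    { carrier := {a | H.1 ⊆ (idealLevel hfin hsrc I a).1}
      zero_mem' := fun v _ => by
        change (0 : R) • p R v ∈ I
        rw [zero_smul]
        exact I.zero_mem
      add_mem' := fun {a b} ha hb v hv => by
        change (a + b) • p R v ∈ I
        rw [add_smul]
        exact I.add_mem (ha hv) (hb hv)
      smul_mem' := fun c a ha v hv => smul_smul_p_mem (ha hv) c }, by
    intro A
    ext a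
    simp only [Submodule.mem_iInf]
    exact ⟨fun h H hH => (SatHer.subset_join hH).trans h, fun h => SatHer.join_subset h⟩⟩

theorem gammaIdeal_idealFunOf (hfin : E.RowFinite) (hsrc : E.NoSources) (hK : E.ConditionK)
    (I : TwoSidedIdeal (LeavittPathAlgebra R E)) :
    gammaIdeal (idealFunOf hfin hsrc I) = I := by
  have hlevel : ∀ a, ((idealFunOf hfin hsrc I).level a).1 = (idealLevel hfin hsrc I a).1 :=
    fun a => Set.Subset.antisymm ((idealFunOf hfin hsrc I).mem_level a)
      ((idealFunOf hfin hsrc I).mem_iff_subset_level.1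
        (show (idealLevel hfin hsrc I a).1 ⊆ (idealLevel hfin hsrc I a).1 from subset_rfl))
  apply le_antisymm
  · rw [gammaIdeal, TwoSidedIdeal.span_le]
    rintro _ ⟨a, v, hv, rfl⟩
    rw [hlevel] at hv
    exact hv
  · intro x hx
    refine idealSpan_subset (Submodule.span_mono ?_ (mem_idealSpan hfin hsrc hK hx))
    rintro _ ⟨a, l, m, h, rfl⟩
    refine ⟨a, l, m, (smul_p_mem_gammaIdeal _).2 ?_, rfl⟩
    rw [hlevel]
    exact h

theorem gammaIdeal_bijective (hfin : E.RowFinite) (hsrc : E.NoSources) (hK : E.ConditionK) :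
    Function.Bijective (gammaIdeal : IdealFun R E → TwoSidedIdeal (LeavittPathAlgebra R E)) := by
  refine ⟨fun π₁ π₂ h => ?_, fun I => ⟨_, gammaIdeal_idealFunOf hfin hsrc hK I⟩⟩
  refine Subtype.ext (funext fun H => le_antisymm ?_ ?_)
  · exact (gammaIdeal_le_iff π₁ π₂).1 h.le H
  · exact (gammaIdeal_le_iff π₂ π₁).1 h.ge H

end Lattice

end DirectedGraph

theorem theorem6p1 {V W R : Type*} [CommRing R] (E : DirectedGraph V W)
    (hfin : E.RowFinite) (hsrc : E.NoSources) (hK : E.ConditionK) :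
    (∀ I : TwoSidedIdeal (DirectedGraph.LeavittPathAlgebra R E),
      (I : Set (DirectedGraph.LeavittPathAlgebra R E)) = DirectedGraph.idealSpan I) ∧
    ∃ Γ : DirectedGraph.IdealFun R E → TwoSidedIdeal (DirectedGraph.LeavittPathAlgebra R E),
      (∀ π, (Γ π : Set (DirectedGraph.LeavittPathAlgebra R E)) = DirectedGraph.gammaSpan π) ∧
      Function.Bijective Γ ∧
      ∀ π₁ π₂ : DirectedGraph.IdealFun R E,
        Γ π₁ ≤ Γ π₂ ↔ ∀ H : E.SatHer, π₁.1 H ≤ π₂.1 H :=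
  ⟨DirectedGraph.coe_eq_idealSpan hfin hsrc hK, DirectedGraph.gammaIdeal,
    DirectedGraph.coe_gammaIdeal hfin hsrc hK, DirectedGraph.gammaIdeal_bijective hfin hsrc hK,
    DirectedGraph.gammaIdeal_le_iff⟩
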